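/- All Banach spaces are real. Let $V$ be the vector space over $\mathbb{Q}$ of all finitely supported sequences of rational numbers, and let $c_{00}\supseteq V$ be the vector space over $\mathbb{R}$ of all finitely supported sequences of real numbers. A norm on $V$ (that is, a function $\nu\colon V\to\mathbb{R}$ with $\nu(v)=0\iff v=0$, $\nu(v+w)\le\nu(v)+\nu(w)$ and $\nu(qv)=|q|\,\nu(v)$ for $v,w\in V$, $q\in\mathbb{Q}$) extends uniquely to a seminorm on $c_{00}$. Let $\mathcal{B}\subseteq\mathbb{R}^V$ be the set of all norms $\nu$ on $V$ whose extension to $c_{00}$ is a norm, with the Borel structure of the topology inherited from the product topology of $\mathbb{R}^V$. For $\nu\in\mathcal{B}$ let $X_\nu$ be the completion of $(V,\nu)$ or, equivalently, the completion of $c_{00}$ with respect to the extension of $\nu$; it is an infinite-dimensional separable Banach space. For a separable Banach space $X$, let $SB(X)$ be the set of all closed infinite-dimensional linear subspaces of $X$, with the Borel structure inherited from the Effros Borel space of closed subsets of $X$, that is, the $\sigma$-algebra generated by the sets $\{Z\in SB(X) : Z\cap U\neq\emptyset\}$, $U\subseteq X$ open. The space $X$ is called universal if every separable Banach space embeds into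 $X$ by a (not necessarily surjective) linear isometry. Theorem. For every universal separable Banach space $X$, there is a Borel isomorphism (a bijection that is Borel measurable together with its inverse) $\Theta\colon\mathcal{B}\to SB(X)$ such that, for every $\nu\in\mathcal{B}$, the Banach space $\Theta(\nu)$ is linearly isometric to $X_\nu$. -/

import Mathlib

open TopologicalSpace

namespace BanachCoding

noncomputable section

/-! ### Norms on the rational vector space of finitely supported rational sequences -/

/-- `V`: the vector space over `ℚ` of all finitely supported sequences of rationals. -/
abbrev V : Type := ℕ →₀ ℚ

/-- `c₀₀`: the vector space over `ℝ` of all finitely supported real sequences. -/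
abbrev C00 : Type := ℕ →₀ ℝ

/-- The inclusion of `V` into `c₀₀`. -/
def incl (v : V) : C00 := v.mapRange (fun q : ℚ => (q : ℝ)) Rat.cast_zero

/-- `𝓑₀`: the set of all norms on the `ℚ`-vector space `V`, a subset of `ℝ ^ V`. -/
def normsOnV : Set (V → ℝ) :=
  {ν | (∀ v, ν v = 0 ↔ v = 0) ∧ (∀ v w, ν (v + w) ≤ ν v + ν w) ∧
    ∀ (q : ℚ) (v : V), ν (q • v) = |(q : ℝ)| * ν v}

/-- The weighted `ℓ¹` seminorm `∑ i, |y i| * ν (e i)` on `c₀₀`. -/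
def weight (ν : V → ℝ) (y : C00) : ℝ := y.sum fun i t => |t| * ν (Finsupp.single i 1)

/-- The canonical extension of a norm `ν` on `V` to `c₀₀`, as a function. By `canonicalExtension_incl` and
`canonicalExtension_unique` below it is the one and only real seminorm on `c₀₀` that extends
`ν`. -/
def extFun (ν : V → ℝ) (x : C00) : ℝ := ⨅ v : V, (ν v + weight ν (x - incl v))

@[simp] theorem incl_apply (v : V) (i : ℕ) : incl v i = (v i : ℝ) := by
  simp [incl]

theorem incl_add (v w : V) : incl (v + w) = incl v + incl w := by
  ext i; simp

theorem incl_sub (v w : V) : incl (v - w) = incl v - incl w := by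
  ext i; simp

theorem incl_smul (q : ℚ) (v : V) : incl (q • v) = (q : ℝ) • incl v := by
  ext i; simp

theorem norm_nonneg_of_mem {ν : V → ℝ} (hν : ν ∈ normsOnV) (v : V) : 0 ≤ ν v := by
  have h1 := hν.2.1 v ((-1 : ℚ) • v)
  have h2 := hν.2.2 (-1) v
  have h3 : v + (-1 : ℚ) • v = 0 := by simp
  rw [h3, (hν.1 0).2 rfl, h2] at h1
  norm_num at h1
  linarith

theorem weight_eq (ν : V → ℝ) (y : C00) {s : Finset ℕ} (hs : y.support ⊆ s) :
    weight ν y = ∑ i ∈ s, |y i| * ν (Finsupp.single i 1) :=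
  Finsupp.sum_of_support_subset _ hs _ (by simp)

theorem weight_nonneg {ν : V → ℝ} (hν : ν ∈ normsOnV) (y : C00) : 0 ≤ weight ν y :=
  Finset.sum_nonneg fun _ _ => mul_nonneg (abs_nonneg _) (norm_nonneg_of_mem hν _)

theorem weight_zero (ν : V → ℝ) : weight ν 0 = 0 := by simp [weight]

theorem weight_add_le {ν : V → ℝ} (hν : ν ∈ normsOnV) (x y : C00) :
    weight ν (x + y) ≤ weight ν x + weight ν y := by
  classical
  rw [weight_eq ν (x + y) Finsupp.support_add,
    weight_eq ν x (s := x.support ∪ y.support) Finset.subset_union_left,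
    weight_eq ν y (s := x.support ∪ y.support) Finset.subset_union_right,
    ← Finset.sum_add_distrib]
  refine Finset.sum_le_sum fun i _ => ?_
  rw [← add_mul]
  exact mul_le_mul_of_nonneg_right (abs_add_le _ _) (norm_nonneg_of_mem hν _)

theorem weight_smul (ν : V → ℝ) (r : ℝ) (x : C00) :
    weight ν (r • x) = |r| * weight ν x := by
  rw [weight_eq ν (r • x) Finsupp.support_smul, weight_eq ν x subset_rfl, Finset.mul_sum]
  refine Finset.sum_congr rfl fun i _ => ?_
  simp [abs_mul, mul_assoc]

theorem norm_le_weight {ν : V → ℝ} (hν : ν ∈ normsOnV) (v : V) : ν v ≤ weight ν (incl v) := by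
  have key : ∀ s : Finset ℕ, ν (∑ i ∈ s, v i • Finsupp.single i (1 : ℚ)) ≤
      ∑ i ∈ s, |(incl v) i| * ν (Finsupp.single i 1) := by
    classical
    intro s
    induction s using Finset.induction_on with
    | empty => simp [(hν.1 0).2 rfl]
    | insert a s ha ih =>
      rw [Finset.sum_insert ha, Finset.sum_insert ha]
      refine (hν.2.1 _ _).trans (add_le_add ?_ ih)
      rw [hν.2.2, incl_apply]
  have hs : (incl v).support ⊆ v.support := Finsupp.support_mapRange
  rw [weight_eq ν (incl v) hs]
  refine le_trans (le_of_eq ?_) (key v.support)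
  congr 1
  conv_lhs => rw [← Finsupp.sum_single v]
  simp [Finsupp.sum]

theorem extFun_bdd {ν : V → ℝ} (hν : ν ∈ normsOnV) (x : C00) :
    BddBelow (Set.range fun v : V => ν v + weight ν (x - incl v)) :=
  ⟨0, by
    rintro _ ⟨v, rfl⟩
    exact add_nonneg (norm_nonneg_of_mem hν v) (weight_nonneg hν _)⟩

theorem extFun_le {ν : V → ℝ} (hν : ν ∈ normsOnV) (x : C00) (v : V) :
    extFun ν x ≤ ν v + weight ν (x - incl v) :=
  ciInf_le (extFun_bdd hν x) v

theorem extFun_incl {ν : V → ℝ} (hν : ν ∈ normsOnV) (v : V) : extFun ν (incl v) = ν v := by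
  apply le_antisymm
  · simpa [weight_zero] using extFun_le hν (incl v) v
  · refine le_ciInf fun w => ?_
    rw [← incl_sub]
    calc ν v = ν (w + (v - w)) := by rw [add_sub_cancel]
      _ ≤ ν w + ν (v - w) := hν.2.1 _ _
      _ ≤ _ := by gcongr; exact norm_le_weight hν _

theorem extFun_add_le {ν : V → ℝ} (hν : ν ∈ normsOnV) (x y : C00) :
    extFun ν (x + y) ≤ extFun ν x + extFun ν y := by
  refine le_ciInf_add_ciInf fun v w => ?_
  refine (extFun_le hν (x + y) (v + w)).trans ?_
  have h1 := hν.2.1 v w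
  have h2 := weight_add_le hν (x - incl v) (y - incl w)
  have h3 : x + y - incl (v + w) = (x - incl v) + (y - incl w) := by rw [incl_add]; abel
  rw [h3]
  linarith

theorem extFun_smul_le {ν : V → ℝ} (hν : ν ∈ normsOnV) (r : ℝ) (x : C00) :
    extFun ν (r • x) ≤ ‖r‖ * extFun ν x := by
  rw [Real.norm_eq_abs, extFun, extFun, Real.mul_iInf_of_nonneg (abs_nonneg r)]
  refine le_ciInf fun v => ?_
  change extFun ν (r • x) ≤ _
  have hq : ∀ t ∈ Set.range (fun q : ℚ => (q : ℝ)),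
      extFun ν (r • x) ≤ |t| * ν v + (|r| * weight ν (x - incl v) +
        |r - t| * weight ν (incl v)) := by
    rintro _ ⟨q, rfl⟩
    refine (extFun_le hν (r • x) (q • v)).trans ?_
    rw [hν.2.2]
    have h3 : r • x - incl (q • v) = r • (x - incl v) + (r - (q : ℝ)) • incl v := by
      rw [incl_smul, smul_sub, sub_smul]; abel
    have h2 := weight_add_le hν (r • (x - incl v)) ((r - (q : ℝ)) • incl v)
    rw [weight_smul, weight_smul] at h2
    rw [h3]
    simpa using h2
  have hcl : IsClosed {t : ℝ | extFun ν (r • x) ≤ |t| * ν v + (|r| * weight ν (x - incl v) +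
        |r - t| * weight ν (incl v))} :=
    isClosed_le continuous_const (by fun_prop)
  have := hcl.closure_subset_iff.2 hq (Rat.denseRange_cast r)
  simp only [Set.mem_ofPred_eq, sub_self, abs_zero, zero_mul, add_zero] at this
  rw [mul_add]
  exact this

/-- The canonical extension of a norm on `V`, as a real seminorm on `c₀₀`. -/
def canonicalExtension (ν : V → ℝ) (hν : ν ∈ normsOnV) : Seminorm ℝ C00 :=
  Seminorm.ofSMulLE (extFun ν)
    (by
      have h := extFun_incl hν 0
      rw [(hν.1 0).2 rfl] at h
      have h0 : incl 0 = 0 := by ext i; simp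
      rwa [h0] at h)
    (extFun_add_le hν) (extFun_smul_le hν)

theorem canonicalExtension_incl (ν : V → ℝ) (hν : ν ∈ normsOnV) (v : V) :
    canonicalExtension ν hν (incl v) = ν v :=
  extFun_incl hν v

theorem seminorm_le_weight {ν : V → ℝ} (p : Seminorm ℝ C00)
    (hp : ∀ v, p (incl v) = ν v) (y : C00) : p y ≤ weight ν y := by
  have key : ∀ s : Finset ℕ, p (∑ i ∈ s, y i • Finsupp.single i (1 : ℝ)) ≤
      ∑ i ∈ s, |y i| * ν (Finsupp.single i 1) := by
    classical
    intro s
    induction s using Finset.induction_on with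
    | empty => simp
    | insert a s ha ih =>
      rw [Finset.sum_insert ha, Finset.sum_insert ha]
      refine (map_add_le_add p _ _).trans (add_le_add ?_ ih)
      have h1 : incl (Finsupp.single a 1) = Finsupp.single a (1 : ℝ) := by simp [incl]
      rw [map_smul_eq_mul, ← hp, h1, Real.norm_eq_abs]
  rw [weight_eq ν y subset_rfl]
  refine le_trans (le_of_eq ?_) (key y.support)
  congr 1
  conv_lhs => rw [← Finsupp.sum_single y]
  simp [Finsupp.sum]

/-- Rational sequences approximate real ones with respect to the weighted seminorm. -/
theorem exists_weight_sub_lt (ν : V → ℝ) (y : C00) {ε : ℝ} (hε : 0 < ε) :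
    ∃ v : V, weight ν (y - incl v) < ε := by
  have h1 : ∀ a : ℕ, ∃ q : ℚ,
      |y a - (q : ℝ)| * ν (Finsupp.single a 1) < ε / (y.support.card + 1) := by
    intro a
    have ho : IsOpen {s : ℝ | |y a - s| * ν (Finsupp.single a 1) < ε / (y.support.card + 1)} :=
      isOpen_lt (by fun_prop) continuous_const
    have hpos : 0 < ε / (y.support.card + 1) := by positivity
    obtain ⟨q, hq⟩ := Rat.denseRange_cast.exists_mem_open ho ⟨y a, by simpa using hpos⟩
    exact ⟨q, hq⟩
  choose q hq using h1
  refine ⟨Finsupp.indicator y.support fun i _ => q i, ?_⟩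
  have hs : (y - incl (Finsupp.indicator y.support fun i _ => q i)).support ⊆ y.support := by
    intro i hi
    by_contra hn
    have hn' := hn
    rw [Finsupp.mem_support_iff, not_not] at hn'
    simp [Finsupp.indicator_apply, hn'] at hi
  rw [weight_eq ν _ hs]
  calc _ ≤ ∑ i ∈ y.support, ε / (y.support.card + 1) := by
        refine Finset.sum_le_sum fun i hi => ?_
        have := (hq i).le
        rw [Finsupp.sub_apply, incl_apply, Finsupp.indicator_of_mem hi]
        exact this
    _ = y.support.card * (ε / (y.support.card + 1)) := by simp
    _ < ε := by
        have : (0 : ℝ) < y.support.card + 1 := by positivity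
        rw [← mul_div_assoc, div_lt_iff₀ this]
        nlinarith

/-- A real seminorm on `c₀₀` that extends the norm `ν` on `V` is the canonical extension. -/
theorem canonicalExtension_unique (ν : V → ℝ) (hν : ν ∈ normsOnV) (p : Seminorm ℝ C00)
    (hp : ∀ v, p (incl v) = ν v) : p = canonicalExtension ν hν := by
  ext x
  refine eq_of_abs_sub_le_all fun ε hε => ?_
  obtain ⟨v, hv⟩ := exists_weight_sub_lt ν x (half_pos hε)
  have h1 := seminorm_le_weight p hp (x - incl v)
  have h2 := seminorm_le_weight (canonicalExtension ν hν) (canonicalExtension_incl ν hν)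
    (x - incl v)
  have h3 := abs_sub_map_le_sub p x (incl v)
  have h4 := abs_sub_map_le_sub (canonicalExtension ν hν) x (incl v)
  rw [hp] at h3
  rw [canonicalExtension_incl] at h4
  rw [abs_le] at *
  constructor <;> linarith

/-! ### The space `𝓑` of codes and the coded Banach spaces -/

/-- `𝓑`: the set of all norms on `V` whose canonical extension to `c₀₀` is still a norm. It carries
the topology and the Borel `σ`-algebra that it inherits from the product `ℝ ^ V`. -/
def codes : Set (V → ℝ) :=
  {ν | ∃ hν : ν ∈ normsOnV, ∀ x : C00, canonicalExtension ν hν x = 0 → x = 0}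

theorem borelSpace_codes : BorelSpace codes := inferInstance

/-- The canonical extension of a code, as a norm on `c₀₀`. -/
def codeNorm (ν : codes) : AddGroupNorm C00 :=
  { (canonicalExtension ν.1 ν.2.1).toAddGroupSeminorm with
    eq_zero_of_map_eq_zero' := ν.2.2 }

/-- The vector space `c₀₀`, as a type that carries the norm with the code `ν`. -/
def PreSpace (_ν : codes) : Type := C00

instance (ν : codes) : NormedAddCommGroup (PreSpace ν) :=
  (codeNorm ν).toNormedAddCommGroup

instance (ν : codes) : Module ℝ (PreSpace ν) := inferInstanceAs (Module ℝ C00)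

instance (ν : codes) : NormedSpace ℝ (PreSpace ν) where
  norm_smul_le r x := (map_smul_eq_mul (canonicalExtension ν.1 ν.2.1) r x).le

/-- `X_ν`: the real Banach space coded by `ν`, the completion of `c₀₀` in the canonical extension
of `ν`. By `norm_toCoded` and `denseRange_toCoded` it is also the completion of `(V, ν)`. -/
abbrev CodedSpace (ν : codes) : Type := UniformSpace.Completion (PreSpace ν)

/-- The canonical map of `V` into `X_ν`. -/
def toCoded (ν : codes) (v : V) : CodedSpace ν :=
  ((show PreSpace ν from incl v : PreSpace ν) : UniformSpace.Completion (PreSpace ν))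

theorem norm_toCoded (ν : codes) (v : V) : ‖toCoded ν v‖ = ν.1 v := by
  rw [toCoded, UniformSpace.Completion.norm_coe]
  exact canonicalExtension_incl ν.1 ν.2.1 v

theorem denseRange_toCoded (ν : codes) : DenseRange (toCoded ν) := by
  have h : DenseRange (fun v : V => (show PreSpace ν from incl v : PreSpace ν)) := by
    intro x
    rw [Metric.mem_closure_iff]
    intro ε hε
    obtain ⟨v, hv⟩ := exists_weight_sub_lt ν.1 x hε
    refine ⟨_, ⟨v, rfl⟩, ?_⟩
    rw [dist_eq_norm]
    exact (seminorm_le_weight (canonicalExtension ν.1 ν.2.1)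
      (canonicalExtension_incl ν.1 ν.2.1) _).trans_lt hv
  exact UniformSpace.Completion.denseRange_coe.comp h (UniformSpace.Completion.continuous_coe _)

/-! ### Bossard's space `SB(X)` -/

/-- The Effros Borel structure on the set `F(X)` of closed subsets of `X`: the `σ`-algebra generated
by the sets `{F | F ∩ U ≠ ∅}` for open `U`. -/
abbrev effrosBorel (X : Type*) [TopologicalSpace X] : MeasurableSpace (Closeds X) :=
  MeasurableSpace.generateFrom
    {S | ∃ U : Set X, IsOpen U ∧ S = {F : Closeds X | ((F : Set X) ∩ U).Nonempty}}

/-- `SB(X)`: the set of all infinite-dimensional closed linear subspaces of `X`. -/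
def SB (X : Type*) [NormedAddCommGroup X] [NormedSpace ℝ X] : Type _ :=
  {Z : ClosedSubmodule ℝ X // ¬ FiniteDimensional ℝ Z.toSubmodule}

/-- `SB(X)` with the `σ`-algebra that it inherits from the Effros Borel space `F(X)`. -/
instance (X : Type*) [NormedAddCommGroup X] [NormedSpace ℝ X] : MeasurableSpace (SB X) :=
  (effrosBorel X).comap fun Z => Z.1.toCloseds

/-- `X` is universal for separable Banach spaces: each real separable Banach space embeds into `X`
by a linear isometry, not necessarily surjective. Quantifying over the lowest universe loses no
generality, since each separable Banach space is isometric to one there. -/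
def IsUniversal (X : Type*) [NormedAddCommGroup X] [NormedSpace ℝ X] : Prop :=
  ∀ (Y : Type) [NormedAddCommGroup Y] [NormedSpace ℝ Y] [CompleteSpace Y] [SeparableSpace Y],
    Nonempty (Y →ₗᵢ[ℝ] X)

end

end BanachCoding

/-! Both spaces are standard Borel, so by Lusin–Souslin an injective Borel map either way is a
measurable embedding. Given such maps `f : codes → SB X` and `g : SB X → codes` that both keep the
isometry class, Schröder–Bernstein gives a Borel isomorphism that at each point is either `f` or an
inverse of `g`. It therefore keeps the isometry class too (`exists_measurableEquiv_eq_or`).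

Linearly independent sequences are the common link: such a sequence yields the code `pullbackNorm`
and the subspace `closedSpan`, both Borel in the sequence, and the coded space is isometric to the
subspace.

From subspaces to codes, a Castaing representation gives a dense sequence in each `Z`, and deleting
the terms that depend on earlier ones gives a Borel right inverse of `closedSpan`. Rescaling its
sequences by a factor that encodes `Z` makes `g` injective.

From codes to subspaces, `V` with norm `ν` embeds into the functions on its dual unit ball, a closed
convex part of the Hilbert cube. Composing with the nearest-point retraction of the cube onto that
ball gives a sequence in one fixed space, `C(Cube, ℝ)`, that realizes `ν` and is Borel in `ν`.
Universality carries two copies of this space into `X`. The graphs of `c • id`, for `c` in `[0, 1]`,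
are isometric copies of `C(Cube, ℝ)` that meet pairwise only in zero, so a `c` that encodes `ν`
makes `f` injective. -/

namespace MeasurableEmbedding

/-! ### Schröder–Bernstein for measurable embeddings. -/

/-- The measurable Schröder–Bernstein theorem, with the information that the equivalence is pieced
together from the two given embeddings. -/
theorem exists_measurableEquiv_eq_or {α β : Type*} [MeasurableSpace α] [MeasurableSpace β]
    {f : α → β} {g : β → α} (hf : MeasurableEmbedding f) (hg : MeasurableEmbedding g) :
    ∃ e : α ≃ᵐ β, ∀ a, e a = f a ∨ g (e a) = a := by
  classical
  -- `A` is the intersection of the decreasing iterates of `F` from the whole space. Taking a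
  -- countable intersection, instead of Knaster–Tarski, keeps `A` measurable; it is a fixed point
  -- because the image under the injective `f` commutes with intersections.
  obtain ⟨A, hA, hfix⟩ : ∃ A : Set α, MeasurableSet A ∧ (g '' (f '' A)ᶜ)ᶜ = A := by
    let F : Set α → Set α := fun A => (g '' (f '' A)ᶜ)ᶜ
    have hmono : ∀ {A B}, A ⊆ B → F A ⊆ F B := fun h =>
      Set.compl_subset_compl.mpr <| Set.image_mono <| Set.compl_subset_compl.mpr <|
        Set.image_mono h
    let S : ℕ → Set α := fun n => F^[n] Set.univ
    have hS : ∀ n, S (n + 1) = F (S n) := fun n => Function.iterate_succ_apply' _ _ _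
    refine ⟨⋂ n, S n, MeasurableSet.iInter fun n => ?_, Set.Subset.antisymm ?_ ?_⟩
    · induction n with
      | zero => exact MeasurableSet.univ
      | succ n ih =>
        rw [hS]
        exact (hg.measurableSet_image' (hf.measurableSet_image' ih).compl).compl
    · refine Set.subset_iInter fun n => ?_
      cases n with
      | zero => exact Set.subset_univ _
      | succ n =>
        rw [hS]
        exact hmono (Set.iInter_subset _ _)
    · rintro x hx ⟨y, hy, rfl⟩
      rw [Set.mem_iInter] at hx
      apply hy
      rw [hf.injective.injOn.image_iInter_eq, Set.mem_iInter]
      intro n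
      have h := hx (n + 1)
      rw [hS] at h
      by_contra h'
      exact h ⟨y, h', rfl⟩
  have hex : ∀ a, a ∉ A → ∃ b, b ∉ f '' A ∧ g b = a := by
    intro a ha
    rw [← hfix, Set.mem_compl_iff, not_not] at ha
    exact ha
  choose k hk hgk using hex
  have hgA : ∀ b, g b ∈ A ↔ b ∈ f '' A := by
    intro b
    rw [← hfix, hfix, ← not_iff_not]
    constructor
    · intro hb hb'
      obtain h := hk _ hb
      rw [hg.injective (hgk _ hb)] at h
      exact h hb'
    · intro hb hb'
      rw [← hfix] at hb'
      exact hb' ⟨b, hb, rfl⟩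
  let e : α → β := fun a => if h : a ∈ A then f a else k a h
  have e_pos : ∀ a, a ∈ A → e a = f a := fun a h => dif_pos h
  have e_neg : ∀ a, a ∉ A → g (e a) = a := fun a h => by simp only [e, dif_neg h, hgk]
  have e_mem : ∀ a, e a ∈ f '' A ↔ a ∈ A := by
    intro a
    by_cases h : a ∈ A
    · exact ⟨fun _ => h, fun _ => ⟨a, h, (e_pos a h).symm⟩⟩
    · rw [← hgA, e_neg a h]
  have hbij : Function.Bijective e := by
    constructor
    · intro a b hab
      by_cases ha : a ∈ A
      · have hb : b ∈ A := by rwa [← e_mem, ← hab, e_mem]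
        rw [e_pos a ha, e_pos b hb] at hab
        exact hf.injective hab
      · have hb : b ∉ A := by rwa [← e_mem, ← hab, e_mem]
        rw [← e_neg a ha, hab, e_neg b hb]
    · intro b
      by_cases hb : b ∈ f '' A
      · obtain ⟨a, ha, rfl⟩ := hb
        exact ⟨a, e_pos a ha⟩
      · exact ⟨g b, hg.injective (e_neg _ (by rwa [hgA]))⟩
  refine ⟨⟨Equiv.ofBijective e hbij, ?_, ?_⟩, fun a => ?_⟩
  · intro T hT
    have : e ⁻¹' T = (A ∩ f ⁻¹' T) ∪ (Aᶜ ∩ g '' T) := by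
      ext a
      by_cases ha : a ∈ A
      · simp [ha, e_pos]
      · simp only [Set.mem_preimage, Set.mem_union, Set.mem_inter_iff, ha, false_and, false_or,
          Set.mem_compl_iff, not_false_eq_true, true_and]
        refine ⟨fun h => ⟨_, h, e_neg a ha⟩, ?_⟩
        rintro ⟨b, hb, hba⟩
        rwa [← hg.injective ((e_neg a ha).trans hba.symm)] at hb
    change MeasurableSet (e ⁻¹' T)
    rw [this]
    exact (hA.inter (hf.measurable hT)).union (hA.compl.inter (hg.measurableSet_image' hT))
  · intro T hT
    have : (Equiv.ofBijective e hbij).symm ⁻¹' T = f '' (A ∩ T) ∪ g ⁻¹' (Aᶜ ∩ T) := by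
      ext b
      obtain ⟨a, rfl⟩ := hbij.2 b
      have h1 : (Equiv.ofBijective e hbij).symm (e a) = a :=
        (Equiv.ofBijective e hbij).symm_apply_apply a
      rw [Set.mem_preimage, h1]
      by_cases ha : a ∈ A
      · have h2 : g (e a) ∈ A := by rw [hgA, e_mem]; exact ha
        simp [e_pos a ha, hf.injective.mem_set_image, ha]
        intro h3
        exact absurd (e_pos a ha ▸ h2) h3
      · have h2 : e a ∉ f '' (A ∩ T) := fun h =>
          ha ((e_mem a).1 (Set.image_mono Set.inter_subset_left h))
        simp [h2, e_neg a ha, ha]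
    change MeasurableSet ((Equiv.ofBijective e hbij).symm ⁻¹' T)
    rw [this]
    exact (hf.measurableSet_image' (hA.inter hT)).union (hg.measurable (hA.compl.inter hT))
  · by_cases ha : a ∈ A
    · exact Or.inl (e_pos a ha)
    · exact Or.inr (e_neg a ha)

end MeasurableEmbedding

/-! ### Measurability criteria and standard Borel retracts. -/

/-- A function into a separable metric space is measurable as soon as the preimages of closed balls
are measurable. -/
theorem measurable_of_measurableSet_preimage_closedBall {α E : Type*} [MeasurableSpace α]
    [PseudoMetricSpace E] [SeparableSpace E] [MeasurableSpace E] [BorelSpace E] {f : α → E}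
    (h : ∀ x r, MeasurableSet (f ⁻¹' Metric.closedBall x r)) : Measurable f := by
  refine measurable_of_isOpen fun U hU => ?_
  obtain ⟨D, hDc, hD⟩ := exists_countable_dense E
  have : U = ⋃ x ∈ D, ⋃ q ∈ {q : ℚ | Metric.closedBall x (q : ℝ) ⊆ U},
      Metric.closedBall x (q : ℝ) := by
    refine Set.Subset.antisymm (fun y hy => ?_) (Set.iUnion₂_subset fun x _ =>
      Set.iUnion₂_subset fun q hq => hq)
    obtain ⟨ε, hε, hU'⟩ := Metric.isOpen_iff.1 hU y hy
    obtain ⟨q, hq0, hq⟩ := exists_rat_btwn (half_pos hε)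
    obtain ⟨x, hx, hxy⟩ := Metric.dense_iff.1 hD y q hq0
    simp only [Set.mem_iUnion]
    refine ⟨x, hxy, q, fun z hz => hU' ?_, ?_⟩
    · rw [Metric.mem_ball] at hx ⊢
      rw [Metric.mem_closedBall] at hz
      linarith [dist_triangle z x y]
    · rw [Metric.mem_ball] at hx
      rw [Metric.mem_closedBall, dist_comm]
      exact hx.le
  rw [this, Set.preimage_iUnion₂]
  refine MeasurableSet.biUnion hDc fun x _ => ?_
  rw [Set.preimage_iUnion₂]
  exact MeasurableSet.biUnion (Set.to_countable _) fun q _ => h x q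

/-- A measurable retract of a standard Borel space is a standard Borel space. -/
theorem StandardBorelSpace.of_measurable_leftInverse {α β : Type*} [MeasurableSpace α]
    [MeasurableSpace β] [StandardBorelSpace β] {s : α → β} {p : β → α} (hs : Measurable s)
    (hp : Measurable p) (h : Function.LeftInverse p s) : StandardBorelSpace α := by
  -- The image of a section is the fixed-point set of `s ∘ p`, hence measurable.
  have hrange : Set.range s = {b | s (p b) = b} :=
    Set.Subset.antisymm (by rintro _ ⟨a, rfl⟩; simp [h a]) fun b hb => ⟨p b, hb⟩
  have hm : MeasurableSet (Set.range s) := by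
    rw [hrange]
    exact measurableSet_eq_fun (hs.comp hp) measurable_id
  have he : MeasurableEmbedding s := MeasurableEmbedding.of_measurable_inverse hs hm hp h
  have := hm.standardBorel
  obtain ⟨τ, hb, hP⟩ := StandardBorelSpace.polish (α := Set.range s)
  let e := he.equivRange
  have h1 := e.measurableEmbedding.comap_eq
  have h2 : MeasurableSpace.comap e _ = MeasurableSpace.comap e _ :=
    congrArg (MeasurableSpace.comap e) hb.measurable_eq
  exact ⟨⟨τ.induced e, @BorelSpace.mk _ (τ.induced e) _
    (h1.symm.trans (h2.trans borel_comap.symm)), e.toEquiv.polishSpace_induced⟩⟩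

/-! ### Independent sequences, their codes and their closed spans. -/

namespace BanachCoding

noncomputable section

section Coding

variable {E : Type*} [NormedAddCommGroup E] [NormedSpace ℝ E]

/-- The rational linear combination of a sequence of vectors with coefficients `v`. -/
def combo (x : ℕ → E) (v : V) : E := Finsupp.linearCombination ℝ x (incl v)

theorem combo_eq_sum (x : ℕ → E) (v : V) : combo x v = ∑ i ∈ v.support, (v i : ℝ) • x i := by
  have hs : (incl v).support ⊆ v.support := Finsupp.support_mapRange
  rw [combo, Finsupp.linearCombination_apply, Finsupp.sum_of_support_subset _ hs _ (by simp)]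
  simp

theorem combo_add (x : ℕ → E) (v w : V) : combo x (v + w) = combo x v + combo x w := by
  rw [combo, incl_add, map_add]; rfl

theorem combo_smul (x : ℕ → E) (q : ℚ) (v : V) : combo x (q • v) = (q : ℝ) • combo x v := by
  rw [combo, incl_smul, map_smul]; rfl

theorem combo_single (x : ℕ → E) (i : ℕ) : combo x (Finsupp.single i 1) = x i := by
  have : incl (Finsupp.single i 1) = Finsupp.single i (1 : ℝ) := by simp [incl]
  rw [combo, this, Finsupp.linearCombination_single, one_smul]

theorem incl_eq_zero {v : V} : incl v = 0 ↔ v = 0 := by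
  refine ⟨fun h => ?_, fun h => ?_⟩
  · ext i
    have := DFunLike.congr_fun h i
    simpa using this
  · ext i; simp [h]

/-- The pullback to `V` of the norm along a sequence of vectors. -/
def pullbackNorm (x : ℕ → E) (v : V) : ℝ := ‖combo x v‖

theorem pullbackNorm_mem_normsOnV {x : ℕ → E} (hx : LinearIndependent ℝ x) :
    pullbackNorm x ∈ normsOnV := by
  refine ⟨fun v => ?_, fun v w => ?_, fun q v => ?_⟩
  · rw [pullbackNorm, norm_eq_zero, combo, map_eq_zero_iff _ hx, incl_eq_zero]
  · rw [pullbackNorm, combo_add]; exact norm_add_le _ _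
  · rw [pullbackNorm, combo_smul, norm_smul, Real.norm_eq_abs]; rfl

/-- The pulled-back norm is a real seminorm on `c₀₀` extending `ν`, and there is only one. -/
theorem canonicalExtension_eq_norm {ν : V → ℝ} (hν : ν ∈ normsOnV) {x : ℕ → E}
    (hx : ∀ v, ‖combo x v‖ = ν v) (y : C00) :
    canonicalExtension ν hν y = ‖Finsupp.linearCombination ℝ x y‖ := by
  have := canonicalExtension_unique ν hν ((normSeminorm ℝ E).comp (Finsupp.linearCombination ℝ x))
    hx
  rw [← this]
  rfl

/-- The extension is the norm pulled back along the linear combination map, so it vanishes only at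
zero exactly when that map is injective. -/
theorem mem_codes_iff {ν : V → ℝ} (hν : ν ∈ normsOnV) {x : ℕ → E}
    (hx : ∀ v, ‖combo x v‖ = ν v) : ν ∈ codes ↔ LinearIndependent ℝ x := by
  rw [linearIndependent_iff]
  simp only [codes, Set.mem_ofPred_eq, exists_prop_of_true hν, canonicalExtension_eq_norm hν hx,
    norm_eq_zero]

theorem pullbackNorm_mem_codes {x : ℕ → E} (hx : LinearIndependent ℝ x) :
    pullbackNorm x ∈ codes :=
  (mem_codes_iff (pullbackNorm_mem_normsOnV hx) fun _ => rfl).2 hx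

/-- The closed linear span of a linearly independent sequence. -/
def closedSpan (x : {x : ℕ → E // LinearIndependent ℝ x}) : SB E :=
  ⟨⟨(Submodule.span ℝ (Set.range x.1)).topologicalClosure,
    Submodule.isClosed_topologicalClosure _⟩, fun h => by
      have h1 : LinearIndependent ℝ fun i => (⟨x.1 i, Submodule.le_topologicalClosure _
          (Submodule.subset_span ⟨i, rfl⟩)⟩ :
          (Submodule.span ℝ (Set.range x.1)).topologicalClosure) :=
        LinearIndependent.of_comp (Submodule.subtype _) x.2
      exact Infinite.not_finite (h1.finite)⟩

theorem coe_closedSpan (x : {x : ℕ → E // LinearIndependent ℝ x}) :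
    ((closedSpan x).1 : Set E) = closure (Submodule.span ℝ (Set.range x.1)) :=
  Submodule.topologicalClosure_coe _

theorem SB.ext {Z W : SB E} (h : (Z.1 : Set E) = W.1) : Z = W :=
  Subtype.ext (SetLike.coe_injective h)

theorem range_linearCombination_coe (x : ℕ → E) :
    Set.range (Finsupp.linearCombination ℝ x) = (Submodule.span ℝ (Set.range x) : Set E) := by
  rw [← Finsupp.range_linearCombination]; rfl

/-- Rational linear combinations are dense in the closed linear span. -/
theorem closure_range_combo (x : ℕ → E) :
    closure (Set.range (combo x)) = closure (Submodule.span ℝ (Set.range x) : Set E) := by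
  refine Set.Subset.antisymm (closure_mono ?_) (closure_minimal ?_ isClosed_closure)
  · rw [← range_linearCombination_coe]
    rintro _ ⟨v, rfl⟩
    exact ⟨_, rfl⟩
  · rw [← range_linearCombination_coe]
    rintro _ ⟨y, rfl⟩
    rw [Metric.mem_closure_iff]
    intro ε hε
    obtain ⟨v, hv⟩ := exists_weight_sub_lt (pullbackNorm x) y hε
    refine ⟨_, ⟨v, rfl⟩, lt_of_le_of_lt ?_ hv⟩
    rw [dist_eq_norm, combo, ← map_sub]
    exact seminorm_le_weight ((normSeminorm ℝ E).comp (Finsupp.linearCombination ℝ x))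
      (fun _ => rfl) _

/-- The space coded by `ν` is the closed linear span of each sequence that realizes `ν`. -/
theorem nonempty_codedSpace_equiv_closedSpan [CompleteSpace E] (ν : codes)
    (x : {x : ℕ → E // LinearIndependent ℝ x}) (hx : ∀ v, ‖combo x.1 v‖ = ν.1 v) :
    Nonempty (CodedSpace ν ≃ₗᵢ[ℝ] (closedSpan x).1.toSubmodule) := by
  have hc : IsClosed ((closedSpan x).1.toSubmodule : Set E) := (closedSpan x).1.isClosed
  have : CompleteSpace (closedSpan x).1.toSubmodule := hc.completeSpace_coe
  let e₁ : PreSpace ν →ₗ[ℝ] CodedSpace ν := (UniformSpace.Completion.toComplₗᵢ (𝕜 := ℝ)).toLinearMap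
  let e₂ : PreSpace ν →ₗ[ℝ] (closedSpan x).1.toSubmodule :=
    LinearMap.codRestrict _ (Finsupp.linearCombination ℝ x.1 : C00 →ₗ[ℝ] E) fun y => by
      have : Finsupp.linearCombination ℝ x.1 y ∈ Submodule.span ℝ (Set.range x.1) := by
        rw [← Finsupp.range_linearCombination]; exact ⟨y, rfl⟩
      exact Submodule.le_topologicalClosure _ this
  -- `c₀₀` maps with dense range and the same norm into both complete spaces, so the identity of
  -- `c₀₀` extends to an isometry between them.
  refine ⟨LinearEquiv.extendOfIsometry (LinearEquiv.refl ℝ (PreSpace ν)) e₁ e₂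
    UniformSpace.Completion.denseRange_coe ?_ ?_⟩
  · rw [DenseRange, Subtype.dense_iff]
    rintro y hy
    have hr : Subtype.val '' Set.range e₂ = Submodule.span ℝ (Set.range x.1) := by
      rw [← range_linearCombination_coe, ← Set.range_comp]; rfl
    exact (congrArg (fun S : Set E => y ∈ closure S) hr).mpr hy
  · intro y
    change ‖Finsupp.linearCombination ℝ x.1 y‖ = ‖(y : CodedSpace ν)‖
    rw [UniformSpace.Completion.norm_coe]
    exact (canonicalExtension_eq_norm ν.2.1 hx y).symm

end Coding

/-! ### Borel dependence of spans and codes on the sequence. -/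

section Effros

variable {E : Type*} [NormedAddCommGroup E] [NormedSpace ℝ E]

theorem measurableSet_SB_inter_nonempty {U : Set E} (hU : IsOpen U) :
    MeasurableSet {Z : SB E | ((Z.1 : Set E) ∩ U).Nonempty} :=
  ⟨_, MeasurableSpace.measurableSet_generateFrom ⟨U, hU, rfl⟩, rfl⟩

theorem measurable_SB_iff {α : Type*} [MeasurableSpace α] {f : α → SB E} :
    Measurable f ↔ ∀ U : Set E, IsOpen U → MeasurableSet {a | (((f a).1 : Set E) ∩ U).Nonempty} := by
  refine ⟨fun hf U hU => hf (measurableSet_SB_inter_nonempty hU), fun h => ?_⟩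
  refine measurable_comap_iff.2 (measurable_generateFrom ?_)
  rintro _ ⟨U, hU, rfl⟩
  exact h U hU

variable [SeparableSpace E] [MeasurableSpace E] [BorelSpace E]

theorem measurable_combo (v : V) : Measurable fun x : ℕ → E => combo x v := by
  simp only [combo_eq_sum]
  have : SecondCountableTopology E := UniformSpace.secondCountable_of_separable E
  fun_prop

/-- An open set meets the closed span iff it contains one of the countably many rational
combinations. -/
theorem measurable_closedSpan : Measurable (closedSpan (E := E)) := by
  refine measurable_SB_iff.2 fun U hU => ?_
  have : {x : {x : ℕ → E // LinearIndependent ℝ x} | (((closedSpan x).1 : Set E) ∩ U).Nonempty} =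
      ⋃ v : V, {x | combo x.1 v ∈ U} := by
    ext x
    rw [Set.mem_ofPred_eq, coe_closedSpan, ← closure_range_combo,
      closure_inter_open_nonempty_iff hU]
    simp only [Set.mem_iUnion]
    exact ⟨fun ⟨_, ⟨v, rfl⟩, h⟩ => ⟨v, h⟩, fun ⟨v, h⟩ => ⟨_, ⟨v, rfl⟩, h⟩⟩
  rw [this]
  exact MeasurableSet.iUnion fun v =>
    ((measurable_combo v).comp measurable_subtype_coe) hU.measurableSet

/-- Independence is an open condition on each finite subfamily, and there are countably many of
these. -/
theorem measurableSet_linearIndependent :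
    MeasurableSet {x : ℕ → E | LinearIndependent ℝ x} := by
  have : SecondCountableTopology E := UniformSpace.secondCountable_of_separable E
  have h : {x : ℕ → E | LinearIndependent ℝ x} =
      ⋂ s : Finset ℕ, (fun (x : ℕ → E) (i : s) => x i) ⁻¹' {y | LinearIndependent ℝ y} := by
    ext x
    rw [Set.mem_iInter]
    exact linearIndependent_iff_finset_linearIndependent
  rw [h]
  exact MeasurableSet.iInter fun s =>
    (by fun_prop : Measurable fun (x : ℕ → E) (i : s) => x i)
      isOpen_setOfPred_linearIndependent.measurableSet

theorem measurable_pullbackNorm : Measurable (pullbackNorm (E := E)) :=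
  measurable_pi_iff.2 fun v => (measurable_combo v).norm

end Effros

end

end BanachCoding

/-! ### Measurable selections. -/

section Castaing

variable {α E : Type*} [MeasurableSpace α] [PseudoMetricSpace E] {F : α → Set E}

/-- One step of the Kuratowski–Ryll-Nardzewski construction: an approximate selection of precision
`r` is improved to one of precision `r'`. -/
theorem exists_measurable_approx_selection_step {D : ℕ → E} (hD : DenseRange D)
    (hF : ∀ U, IsOpen U → MeasurableSet {a | (F a ∩ U).Nonempty}) {m : α → ℕ} (hm : Measurable m)
    {r r' : ℝ} (hr' : 0 < r') (h : ∀ a, (F a ∩ Metric.ball (D (m a)) r).Nonempty) :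
    ∃ m' : α → ℕ, Measurable m' ∧ (∀ a, (F a ∩ Metric.ball (D (m' a)) r').Nonempty) ∧
      ∀ a, dist (D (m a)) (D (m' a)) < r + r' := by
  classical
  have hex : ∀ a, ∃ k, (F a ∩ (Metric.ball (D (m a)) r ∩ Metric.ball (D k) r')).Nonempty := by
    intro a
    obtain ⟨z, hz, hzr⟩ := h a
    obtain ⟨k, hk⟩ := hD.exists_dist_lt z hr'
    exact ⟨k, z, hz, hzr, hk⟩
  -- Taking the least admissible index makes the choice measurable.
  refine ⟨fun a => Nat.find (hex a), measurable_find hex fun k => ?_, fun a => ?_, fun a => ?_⟩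
  · have : {a | (F a ∩ (Metric.ball (D (m a)) r ∩ Metric.ball (D k) r')).Nonempty} =
        ⋃ j, m ⁻¹' {j} ∩ {a | (F a ∩ (Metric.ball (D j) r ∩ Metric.ball (D k) r')).Nonempty} := by
      ext a; simp
    rw [this]
    exact MeasurableSet.iUnion fun j => (hm (measurableSet_singleton j)).inter
      (hF _ (Metric.isOpen_ball.inter Metric.isOpen_ball))
  · exact (Nat.find_spec (hex a)).mono (Set.inter_subset_inter_right _ Set.inter_subset_right)
  · obtain ⟨z, -, h1, h2⟩ := Nat.find_spec (hex a)
    rw [Metric.mem_ball] at h1 h2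
    linarith [dist_triangle_left (D (m a)) (D (Nat.find (hex a))) z]

variable [CompleteSpace E] [MeasurableSpace E] [BorelSpace E]

/-- An approximate measurable selection of a closed-valued measurable multifunction is close to a
measurable selection. -/
theorem exists_measurable_selection_near {D : ℕ → E} (hD : DenseRange D)
    (hc : ∀ a, IsClosed (F a))
    (hF : ∀ U, IsOpen U → MeasurableSet {a | (F a ∩ U).Nonempty}) {m : α → ℕ} (hm : Measurable m)
    {r : ℝ} (hr : 0 < r) (h : ∀ a, (F a ∩ Metric.ball (D (m a)) r).Nonempty) :
    ∃ s : α → E, Measurable s ∧ ∀ a, s a ∈ F a ∧ dist (D (m a)) (s a) ≤ 4 * r := by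
  have hpos : ∀ n : ℕ, 0 < r / 2 ^ n := fun n => by positivity
  let P : ℕ → Type _ := fun n => {m : α → ℕ // Measurable m ∧
    ∀ a, (F a ∩ Metric.ball (D (m a)) (r / 2 ^ n)).Nonempty}
  have step : ∀ n, ∀ m : P n, ∃ m' : P (n + 1), ∀ a,
      dist (D (m.1 a)) (D (m'.1 a)) < r / 2 ^ n + r / 2 ^ (n + 1) := by
    intro n m
    obtain ⟨m', h1, h2, h3⟩ :=
      exists_measurable_approx_selection_step hD hF m.2.1 (hpos (n + 1)) m.2.2
    exact ⟨⟨m', h1, h2⟩, h3⟩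
  choose next hnext using step
  let M : ∀ n, P n := fun n => Nat.rec (motive := P) ⟨m, hm, by simpa using h⟩ next n
  -- A step is at most `(3/2) * r / 2 ^ n`, which is rounded up to `2 * r / 2 ^ n`; these bounds sum
  -- to `4 * r`.
  have hu : ∀ a n, dist (D ((M n).1 a)) (D ((M (n + 1)).1 a)) ≤ 4 * r / 2 / 2 ^ n := by
    intro a n
    refine (hnext n (M n) a).le.trans ?_
    have := hpos n
    rw [pow_succ, ← div_div, mul_div_right_comm, mul_div_assoc]
    linarith
  have hlim : ∀ a, ∃ z, Filter.Tendsto (fun n => D ((M n).1 a)) Filter.atTop (nhds z) :=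
    fun a => cauchySeq_tendsto_of_complete (cauchySeq_of_le_geometric_two (hu a))
  choose s hs using hlim
  refine ⟨s, measurable_of_tendsto_metrizable (f := fun n a => D ((M n).1 a)) (fun n => ?_)
    (tendsto_pi_nhds.2 hs), fun a => ⟨?_, dist_le_of_le_geometric_two_of_tendsto₀ (hu a) (hs a)⟩⟩
  · exact (measurable_of_countable D).comp (M n).2.1
  · have hz : ∀ n, ∃ z ∈ F a, dist z (D ((M n).1 a)) < r / 2 ^ n := fun n => (M n).2.2 a
    choose z hzF hz using hz
    refine (hc a).mem_of_tendsto (f := z) (b := Filter.atTop) ?_ (Filter.Eventually.of_forall hzF)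
    refine (tendsto_iff_of_dist (squeeze_zero (fun _ => dist_nonneg) (fun n => (hz n).le) ?_)).2
      (hs a)
    have := (tendsto_pow_atTop_nhds_zero_of_lt_one (r := (1 / 2 : ℝ)) (by norm_num)
      (by norm_num)).const_mul r
    simpa [div_eq_mul_inv] using this

/-- **Castaing representation**: a measurable multifunction with closed nonempty values in a
separable complete metric space has a dense sequence of measurable selections. -/
theorem exists_measurable_dense_selections [SeparableSpace E] (hc : ∀ a, IsClosed (F a))
    (hne : ∀ a, (F a).Nonempty) (hF : ∀ U, IsOpen U → MeasurableSet {a | (F a ∩ U).Nonempty}) :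
    ∃ d : ℕ → α → E, (∀ n, Measurable (d n)) ∧ (∀ n a, d n a ∈ F a) ∧
      ∀ a, F a ⊆ closure (Set.range fun n => d n a) := by
  classical
  rcases isEmpty_or_nonempty α with hα | ⟨⟨a₀⟩⟩
  · exact ⟨fun _ => isEmptyElim, fun _ => measurable_of_empty _, fun _ a => isEmptyElim a,
      fun a => isEmptyElim a⟩
  have : Nonempty E := ⟨(hne a₀).some⟩
  have hD := denseRange_denseSeq E
  set D := denseSeq E
  have key : ∀ j k : ℕ, ∃ s : α → E, Measurable s ∧ (∀ a, s a ∈ F a) ∧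
      ∀ a, (F a ∩ Metric.ball (D j) (1 / (k + 1))).Nonempty →
        dist (D j) (s a) ≤ 4 * (1 / (k + 1)) := by
    intro j k
    have hk : (0 : ℝ) < 1 / (k + 1) := by positivity
    -- The selection must start from `D j` where this ball meets `F a`; elsewhere any starting index
    -- will do.
    have hex : ∀ a, ∃ i, ((F a ∩ Metric.ball (D j) (1 / (k + 1))).Nonempty → i = j) ∧
        (F a ∩ Metric.ball (D i) (1 / (k + 1))).Nonempty := by
      intro a
      by_cases h : (F a ∩ Metric.ball (D j) (1 / (k + 1))).Nonempty
      · exact ⟨j, fun _ => rfl, h⟩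
      · obtain ⟨z, hz⟩ := hne a
        obtain ⟨i, hi⟩ := hD.exists_dist_lt z hk
        exact ⟨i, fun h' => absurd h' h, z, hz, hi⟩
    have hm : Measurable fun a => Nat.find (hex a) := measurable_find hex fun i => by
      by_cases hij : i = j
      · simpa [hij] using hF _ Metric.isOpen_ball
      · simp only [hij, imp_false]
        exact (hF _ Metric.isOpen_ball).compl.inter (hF _ Metric.isOpen_ball)
    obtain ⟨s, hs, hs'⟩ := exists_measurable_selection_near hD hc hF hm hk
      (fun a => (Nat.find_spec (hex a)).2)
    refine ⟨s, hs, fun a => (hs' a).1, fun a h => ?_⟩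
    have := (hs' a).2
    rwa [(Nat.find_spec (hex a)).1 h] at this
  choose s hs hsF hsd using key
  refine ⟨fun n => s n.unpair.1 n.unpair.2, fun n => hs _ _, fun n a => hsF _ _ _, fun a z hz => ?_⟩
  rw [Metric.mem_closure_iff]
  intro ε hε
  -- Five parts: one from `z` to `D j`, four from `D j` to the selection.
  obtain ⟨k, hk⟩ := exists_nat_one_div_lt (show 0 < ε / 5 by positivity)
  have hk0 : (0 : ℝ) < 1 / (k + 1) := by positivity
  obtain ⟨j, hj⟩ := hD.exists_dist_lt z hk0
  refine ⟨_, ⟨Nat.pair j k, rfl⟩, ?_⟩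
  simp only [Nat.unpair_pair]
  have := hsd j k a ⟨z, hz, hj⟩
  linarith [dist_triangle z (D j) (s j k a)]

end Castaing

/-! ### Measurable thinning to an independent sequence with the same span. -/

theorem measurable_nat_nth {α : Type*} [MeasurableSpace α] {p : α → ℕ → Prop}
    (hp : ∀ k, MeasurableSet {a | p a k}) (hinf : ∀ a, (Set.ofPred (p a)).Infinite) (n : ℕ) :
    Measurable fun a => Nat.nth (p a) n := by
  classical
  have hcount : ∀ k, Measurable fun a => Nat.count (p a) k := by
    intro k
    induction k with
    | zero => simp
    | succ k ih =>
      simp only [Nat.count_succ]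
      exact ih.add (Measurable.ite (hp k) measurable_const measurable_const)
  refine measurable_to_countable' fun k => ?_
  have : (fun a => Nat.nth (p a) n) ⁻¹' {k} =
      {a | p a k} ∩ (fun a => Nat.count (p a) k) ⁻¹' {n} := by
    ext a
    constructor
    · rintro rfl
      exact ⟨Nat.nth_mem_of_infinite (hinf a) n, Nat.count_nth_of_infinite (hinf a) n⟩
    · rintro ⟨h1, rfl⟩
      exact Nat.nth_count h1
  rw [this]
  exact (hp k).inter (hcount k (measurableSet_singleton n))

section IndependentIndices

variable {K M : Type*} [DivisionRing K] [AddCommGroup M] [Module K M] (x : ℕ → M)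

/-- Each kept vector lies outside the span of all earlier ones, so the kept indices below `n` stay
independent as `n` grows; then pass to the directed union. -/
theorem linearIndepOn_setOf_notMem_span :
    LinearIndepOn K x {m | x m ∉ Submodule.span K (x '' Set.Iio m)} := by
  set S := {m | x m ∉ Submodule.span K (x '' Set.Iio m)}
  have hS : S = ⋃ n, S ∩ Set.Iio n := by
    rw [← Set.inter_iUnion, Set.iUnion_Iio, Set.inter_univ]
  rw [hS]
  refine linearIndepOn_iUnion_of_directed (Monotone.directed_le fun m n h =>
    Set.inter_subset_inter_right _ (Set.Iio_subset_Iio h)) fun n => ?_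
  induction n with
  | zero => simp
  | succ n ih =>
    by_cases hn : n ∈ S
    · refine (ih.insert fun h => hn (Submodule.span_mono
        (Set.image_mono Set.inter_subset_right) h)).mono ?_
      rintro m ⟨hm, hmn⟩
      rcases (Nat.lt_succ_iff_lt_or_eq.1 hmn) with h | rfl
      · exact Or.inr ⟨hm, h⟩
      · exact Or.inl rfl
    · refine ih.mono ?_
      rintro m ⟨hm, hmn⟩
      rcases (Nat.lt_succ_iff_lt_or_eq.1 hmn) with h | rfl
      · exact ⟨hm, h⟩
      · exact absurd hm hn

theorem span_image_setOf_notMem_span :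
    Submodule.span K (x '' {m | x m ∉ Submodule.span K (x '' Set.Iio m)}) =
      Submodule.span K (Set.range x) := by
  refine le_antisymm (Submodule.span_mono (Set.image_subset_range _ _)) (Submodule.span_le.2 ?_)
  rintro _ ⟨n, rfl⟩
  induction n using Nat.strong_induction_on with
  | _ n ih =>
    by_cases hn : x n ∈ Submodule.span K (x '' Set.Iio n)
    · refine (Submodule.span_le.2 ?_) hn
      rintro _ ⟨m, hm, rfl⟩
      exact ih m hm
    · exact Submodule.subset_span ⟨n, hn, rfl⟩

end IndependentIndices

/-! ### From subspaces to codes. -/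

namespace BanachCoding

noncomputable section

variable {E : Type*} [NormedAddCommGroup E] [NormedSpace ℝ E]

variable [SeparableSpace E] [MeasurableSpace E] [BorelSpace E]

/-- A finite-dimensional span is closed, so membership means approximation by rational combinations
to every precision `1 / (n + 1)`. -/
theorem measurableSet_mem_span (m : ℕ) :
    MeasurableSet {x : ℕ → E | x m ∈ Submodule.span ℝ (x '' Set.Iio m)} := by
  classical
  have : SecondCountableTopology E := UniformSpace.secondCountable_of_separable E
  -- Padding with zeros turns the span of an initial segment into that of a full sequence, to which
  -- `combo` applies.
  let T : (ℕ → E) → ℕ → E := fun x i => if i < m then x i else 0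
  have hT : ∀ x, Submodule.span ℝ (x '' Set.Iio m) = Submodule.span ℝ (Set.range (T x)) := by
    intro x
    refine le_antisymm (Submodule.span_mono ?_) (Submodule.span_le.2 ?_)
    · rintro _ ⟨i, hi, rfl⟩
      exact ⟨i, if_pos hi⟩
    · rintro _ ⟨i, rfl⟩
      by_cases hi : i < m
      · simp only [T, if_pos hi]
        exact Submodule.subset_span ⟨i, hi, rfl⟩
      · simp only [T, if_neg hi]
        exact Submodule.zero_mem _
  have hmT : Measurable T := measurable_pi_iff.2 fun i => by
    by_cases hi : i < m
    · simp only [T, if_pos hi]; fun_prop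
    · simp only [T, if_neg hi]; fun_prop
  have : {x : ℕ → E | x m ∈ Submodule.span ℝ (x '' Set.Iio m)} =
      ⋂ n : ℕ, ⋃ v : V, {x | dist (x m) (combo (T x) v) < 1 / ((n : ℝ) + 1)} := by
    ext x
    have hfin : FiniteDimensional ℝ (Submodule.span ℝ (Set.range (T x))) := by
      rw [← hT]
      exact FiniteDimensional.span_of_finite ℝ ((Set.finite_Iio m).image x)
    rw [Set.mem_ofPred_eq, hT, ← SetLike.mem_coe,
      ← (Submodule.closed_of_finiteDimensional (Submodule.span ℝ (Set.range (T x)))).closure_eq,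
      ← closure_range_combo, Metric.mem_closure_iff]
    simp only [Set.mem_iInter, Set.mem_iUnion, Set.mem_ofPred_eq, Set.exists_range_iff]
    refine ⟨fun h n => h _ (by positivity), fun h ε hε => ?_⟩
    obtain ⟨n, hn⟩ := exists_nat_one_div_lt hε
    obtain ⟨v, hv⟩ := h n
    exact ⟨v, hv.trans hn⟩
  rw [this]
  exact MeasurableSet.iInter fun n => MeasurableSet.iUnion fun v =>
    measurableSet_lt ((measurable_pi_apply m).dist ((measurable_combo v).comp hmT))
      measurable_const

/-- Each closed infinite-dimensional subspace has a linearly independent sequence with a dense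
linear span, and it can be selected measurably. -/
theorem exists_measurable_section_closedSpan [CompleteSpace E] :
    ∃ s : SB E → {x : ℕ → E // LinearIndependent ℝ x},
      Measurable s ∧ ∀ Z, closedSpan (s Z) = Z := by
  classical
  obtain ⟨d, hd, hdZ, hdense⟩ := exists_measurable_dense_selections (α := SB E) (E := E)
    (F := fun Z => (Z.1 : Set E)) (fun Z => Z.1.isClosed) (fun Z => ⟨0, zero_mem _⟩)
    (fun U hU => measurableSet_SB_inter_nonempty hU)
  have hclos : ∀ Z : SB E, closure (Submodule.span ℝ (Set.range fun n => d n Z) : Set E) = Z.1 := by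
    intro Z
    refine Set.Subset.antisymm (closure_minimal ?_ Z.1.isClosed)
      ((hdense Z).trans (closure_mono Submodule.subset_span))
    refine Submodule.span_le (p := Z.1.toSubmodule).2 ?_
    rintro _ ⟨n, rfl⟩
    exact hdZ n Z
  let p : SB E → ℕ → Prop := fun Z m =>
    d m Z ∉ Submodule.span ℝ ((fun n => d n Z) '' Set.Iio m)
  -- With finitely many kept indices the span would be finite-dimensional, hence closed, hence all
  -- of `Z`.
  have hinf : ∀ Z, (Set.ofPred (p Z)).Infinite := by
    intro Z hfin
    have h1 : FiniteDimensional ℝ (Submodule.span ℝ (Set.range fun n => d n Z)) := by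
      rw [← span_image_setOf_notMem_span]
      exact FiniteDimensional.span_of_finite ℝ (hfin.image _)
    have h2 := hclos Z
    rw [(Submodule.closed_of_finiteDimensional _).closure_eq] at h2
    have h3 : Submodule.span ℝ (Set.range fun n => d n Z) = Z.1.toSubmodule :=
      SetLike.coe_injective h2
    exact Z.2 (h3 ▸ h1)
  have hp : ∀ k, MeasurableSet {Z | p Z k} := fun k =>
    (measurable_pi_iff.2 hd : Measurable fun (Z : SB E) n => d n Z)
      (measurableSet_mem_span k).compl
  have hk : ∀ n, Measurable fun Z => Nat.nth (p Z) n := measurable_nat_nth hp hinf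
  refine ⟨fun Z => ⟨fun n => d (Nat.nth (p Z) n) Z, ?_⟩, ?_, fun Z => SB.ext ?_⟩
  · exact (linearIndepOn_setOf_notMem_span (K := ℝ) fun n => d n Z).linearIndependent.comp
      (fun n => ⟨Nat.nth (p Z) n, Nat.nth_mem_of_infinite (hinf Z) n⟩)
      fun a b h => Nat.nth_injective (hinf Z) (congrArg Subtype.val h)
  · refine Measurable.subtype_mk (measurable_pi_iff.2 fun n => ?_)
    have h1 : Measurable fun q : SB E × ℕ => d q.2 q.1 :=
      measurable_from_prod_countable_left fun k => hd k
    exact h1.comp (measurable_id.prodMk (hk n))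
  · rw [coe_closedSpan, ← hclos Z, ← span_image_setOf_notMem_span (x := fun n => d n Z)]
    congr 3
    have := Nat.range_nth_of_infinite (hinf Z)
    change _ = (fun n => d n Z) '' Set.ofPred (p Z)
    rw [← this, ← Set.range_comp]
    rfl

/-- The Borel section makes `SB E` a measurable retract of the Borel set of independent sequences.
-/
theorem standardBorelSpace_SB [CompleteSpace E] : StandardBorelSpace (SB E) := by
  have : SecondCountableTopology E := UniformSpace.secondCountable_of_separable E
  obtain ⟨s, hs, h⟩ := exists_measurable_section_closedSpan (E := E)
  have : StandardBorelSpace {x : ℕ → E // LinearIndependent ℝ x} :=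
    measurableSet_linearIndependent.standardBorel
  exact StandardBorelSpace.of_measurable_leftInverse hs measurable_closedSpan h

/-- `SB(E)` embeds into the space of codes, in a Borel way and with the isometry class kept. -/
theorem exists_measurable_injective_SB_codes [CompleteSpace E] :
    ∃ g : SB E → codes, Measurable g ∧ Function.Injective g ∧
      ∀ Z, Nonempty (CodedSpace (g Z) ≃ₗᵢ[ℝ] Z.1.toSubmodule) := by
  have : SecondCountableTopology E := UniformSpace.secondCountable_of_separable E
  obtain ⟨s, hs, hsZ⟩ := exists_measurable_section_closedSpan (E := E)
  have := standardBorelSpace_SB (E := E)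
  obtain ⟨φ, hφ⟩ := MeasureTheory.exists_measurableEmbedding_real (SB E)
  -- The first rescaled vector has norm `exp (φ Z)`, so the code determines `Z`; the closed span
  -- does not change.
  let c : SB E → ℕ → ℝ := fun Z i => Real.exp (φ Z) / ‖(s Z).1 0‖
  have hc : ∀ Z i, c Z i ≠ 0 := fun Z i =>
    div_ne_zero (Real.exp_ne_zero _) (norm_ne_zero_iff.2 ((s Z).2.ne_zero 0))
  have hmc : Measurable c := by
    have hm : Measurable fun Z => (s Z).1 0 := (measurable_pi_apply 0).comp hs.subtype_val
    have := hφ.measurable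
    exact measurable_pi_iff.2 fun i => by fun_prop
  let t : SB E → {x : ℕ → E // LinearIndependent ℝ x} := fun Z =>
    ⟨fun i => c Z i • (s Z).1 i, (s Z).2.units_smul fun i => Units.mk0 (c Z i) (hc Z i)⟩
  have ht : ∀ Z, closedSpan (t Z) = Z := by
    intro Z
    rw [← hsZ Z]
    refine SB.ext ?_
    rw [coe_closedSpan, coe_closedSpan, hsZ Z]
    congr 2
    refine le_antisymm (Submodule.span_le.2 ?_) (Submodule.span_le.2 ?_)
    · rintro _ ⟨i, rfl⟩
      exact Submodule.smul_mem _ _ (Submodule.subset_span ⟨i, rfl⟩)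
    · rintro _ ⟨i, rfl⟩
      have h1 : (c Z i)⁻¹ • (t Z).1 i ∈ Submodule.span ℝ (Set.range (t Z).1) :=
        Submodule.smul_mem _ _ (Submodule.subset_span ⟨i, rfl⟩)
      simpa [t, smul_smul, inv_mul_cancel₀ (hc Z i)] using h1
  refine ⟨fun Z => ⟨pullbackNorm (t Z).1, pullbackNorm_mem_codes (t Z).2⟩, ?_, ?_, fun Z => ?_⟩
  · refine Measurable.subtype_mk (measurable_pullbackNorm.comp (measurable_pi_iff.2 fun i => ?_))
    exact ((measurable_pi_apply i).comp hmc).smul ((measurable_pi_apply i).comp hs.subtype_val)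
  · intro Z W h
    have h1 : ∀ Z, pullbackNorm (t Z).1 (Finsupp.single 0 1) = Real.exp (φ Z) := by
      intro Z
      have h0 : ‖(s Z).1 0‖ ≠ 0 := norm_ne_zero_iff.2 ((s Z).2.ne_zero 0)
      rw [pullbackNorm, combo_single, norm_smul, Real.norm_of_nonneg (by positivity)]
      exact div_mul_cancel₀ _ h0
    have h2 := congrFun (congrArg Subtype.val h) (Finsupp.single 0 1)
    exact hφ.injective (Real.exp_injective ((h1 Z).symm.trans (h2.trans (h1 W))))
  · have h1 := nonempty_codedSpace_equiv_closedSpan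
      ⟨pullbackNorm (t Z).1, pullbackNorm_mem_codes (t Z).2⟩ (t Z) fun _ => rfl
    rwa [ht Z] at h1

end

end BanachCoding

/-! ### Borel realization of norms in `C(Cube, ℝ)`. -/

theorem Seminorm.exists_dual_eq {E : Type*} [AddCommGroup E] [Module ℝ E] (p : Seminorm ℝ E)
    (x : E) : ∃ g : E →ₗ[ℝ] ℝ, g x = p x ∧ ∀ y, |g y| ≤ p y := by
  by_cases hx : x = 0
  · exact ⟨0, by simp [hx], fun y => by simp⟩
  · have hval : ∀ (c : ℝ) (h), LinearPMap.mkSpanSingleton (K := ℝ) x (p x) hx ⟨c • x, h⟩ =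
        c • p x := fun c h => LinearPMap.mkSpanSingleton'_apply (σ := RingHom.id ℝ) x (p x) _ c h
    obtain ⟨g, hg, hgp⟩ := exists_extension_of_le_sublinear
      (LinearPMap.mkSpanSingleton (K := ℝ) x (p x) hx) p
      (fun c hc y => by rw [map_smul_eq_mul, Real.norm_of_nonneg hc.le]) (map_add_le_add p) (by
        rintro ⟨y, hy⟩
        obtain ⟨c, rfl⟩ := Submodule.mem_span_singleton.1 hy
        rw [hval, map_smul_eq_mul, smul_eq_mul]
        exact mul_le_mul_of_nonneg_right (le_abs_self c) (apply_nonneg p x))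
    refine ⟨g, ?_, p.abs_le_of_le hgp⟩
    have := (hg ⟨(1 : ℝ) • x, Submodule.mem_span_singleton.2 ⟨1, rfl⟩⟩).trans (hval 1 _)
    simpa using this

namespace BanachCoding

noncomputable section

/-- The Hilbert cube. -/
abbrev Cube : Type := ℕ → Set.Icc (-1 : ℝ) 1

/-- A weighted `ℓ²` distance, squared, on the Hilbert cube. -/
def sqDist (f q : Cube) : ℝ := ∑' i, (1 / 2) ^ i * ((f i : ℝ) - q i) ^ 2

theorem norm_sqDist_term_le (f q : Cube) (i : ℕ) :
    ‖(1 / 2 : ℝ) ^ i * ((f i : ℝ) - q i) ^ 2‖ ≤ (1 / 2) ^ i * 4 := by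
  rw [Real.norm_of_nonneg (by positivity)]
  refine mul_le_mul_of_nonneg_left ?_ (by positivity)
  have h1 := (f i).2
  have h2 := (q i).2
  rw [Set.mem_Icc] at h1 h2
  nlinarith

theorem summable_sqDist_bound : Summable fun i : ℕ => (1 / 2 : ℝ) ^ i * 4 :=
  summable_geometric_two.mul_right 4

theorem summable_sqDist (f q : Cube) :
    Summable fun i : ℕ => (1 / 2 : ℝ) ^ i * ((f i : ℝ) - q i) ^ 2 :=
  Summable.of_norm_bounded summable_sqDist_bound (norm_sqDist_term_le f q)

theorem continuous_sqDist : Continuous fun p : Cube × Cube => sqDist p.1 p.2 :=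
  continuous_tsum (fun i => by fun_prop) summable_sqDist_bound
    fun i p => norm_sqDist_term_le p.1 p.2 i

theorem sqDist_self (f : Cube) : sqDist f f = 0 := by simp [sqDist]

theorem eq_of_sqDist_le_zero {f q : Cube} (h : sqDist f q ≤ 0) : f = q := by
  have h0 : ∀ i : ℕ, 0 ≤ (1 / 2 : ℝ) ^ i * ((f i : ℝ) - q i) ^ 2 := fun i => by positivity
  have hs : HasSum _ (sqDist f q) := (summable_sqDist f q).hasSum
  rw [le_antisymm h (tsum_nonneg h0)] at hs
  ext i
  have h1 := congrFun ((hasSum_zero_iff_of_nonneg h0).1 hs) i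
  have h2 := (mul_eq_zero.1 h1).resolve_left (by positivity)
  exact sub_eq_zero.1 (pow_eq_zero_iff two_ne_zero |>.1 h2)

/-- The midpoint of two points of the Hilbert cube. -/
def cubeMid (f g : Cube) : Cube := fun i => ⟨((f i : ℝ) + g i) / 2, by
  have h1 := (f i).2
  have h2 := (g i).2
  rw [Set.mem_Icc] at *
  constructor <;> linarith⟩

/-- The parallelogram identity: it supplies the strict convexity that makes nearest points unique.
-/
theorem sqDist_cubeMid (f g q : Cube) :
    sqDist (cubeMid f g) q = sqDist f q / 2 + sqDist g q / 2 - sqDist f g / 4 := by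
  simp only [sqDist]
  rw [← tsum_div_const, ← tsum_div_const, ← tsum_div_const,
    ← ((summable_sqDist f q).div_const 2).tsum_add ((summable_sqDist g q).div_const 2),
    ← (((summable_sqDist f q).div_const 2).add ((summable_sqDist g q).div_const 2)).tsum_sub
      ((summable_sqDist f g).div_const 4)]
  refine tsum_congr fun i => ?_
  simp only [cubeMid]
  ring

/-- The coordinates of a functional on `V`, recovered from their quotients by `ν (e i)`. -/
def rescale (ν : V → ℝ) (f : Cube) (i : ℕ) : ℝ := ν (Finsupp.single i 1) * f i

/-- The dual unit ball of `(V, ν)`, as a subset of the Hilbert cube. -/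
def dualBall (ν : V → ℝ) : Set Cube := {f | ∀ v, |combo (rescale ν f) v| ≤ ν v}

theorem combo_rescale (ν : V → ℝ) (f : Cube) (v : V) :
    combo (rescale ν f) v = ∑ i ∈ v.support, (v i : ℝ) * (ν (Finsupp.single i 1) * f i) :=
  combo_eq_sum _ _

theorem isClosed_setOf_mem_dualBall : IsClosed {p : (V → ℝ) × Cube | p.2 ∈ dualBall p.1} := by
  have h : {p : (V → ℝ) × Cube | p.2 ∈ dualBall p.1} = ⋂ v : V, {p |
      |∑ i ∈ v.support, (v i : ℝ) * (p.1 (Finsupp.single i 1) * p.2 i)| ≤ p.1 v} := by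
    ext p
    simp only [Set.mem_iInter, ← combo_rescale]
    rfl
  rw [h]
  exact isClosed_iInter fun v => isClosed_le (by fun_prop) (by fun_prop)

theorem isClosed_dualBall (ν : V → ℝ) : IsClosed (dualBall ν) :=
  isClosed_setOf_mem_dualBall.preimage (by fun_prop : Continuous fun f : Cube => (ν, f))

theorem cubeMid_mem_dualBall {ν : V → ℝ} {f g : Cube} (hf : f ∈ dualBall ν)
    (hg : g ∈ dualBall ν) : cubeMid f g ∈ dualBall ν := by
  intro v
  have : combo (rescale ν (cubeMid f g)) v =
      combo (rescale ν f) v / 2 + combo (rescale ν g) v / 2 := by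
    simp only [combo_rescale, Finset.sum_div, ← Finset.sum_add_distrib]
    refine Finset.sum_congr rfl fun i _ => ?_
    simp only [cubeMid]
    ring
  have h1 := abs_le.1 (hf v)
  have h2 := abs_le.1 (hg v)
  rw [this, abs_le]
  constructor <;> linarith

/-- Hahn–Banach gives a norming functional for the canonical extension; its values at the unit
vectors, divided by `ν (e i) > 0`, lie in `[-1, 1]`. -/
theorem exists_mem_dualBall_combo_eq {ν : V → ℝ} (hν : ν ∈ normsOnV) (v : V) :
    ∃ f ∈ dualBall ν, combo (rescale ν f) v = ν v := by
  obtain ⟨g, hg, hgp⟩ := (canonicalExtension ν hν).exists_dual_eq (incl v)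
  have hpos : ∀ i, 0 < ν (Finsupp.single i 1) := fun i =>
    lt_of_le_of_ne (norm_nonneg_of_mem hν _) fun h =>
      one_ne_zero (Finsupp.single_eq_zero.1 ((hν.1 _).1 h.symm))
  have hincl : ∀ i : ℕ, incl (Finsupp.single i 1) = Finsupp.single i (1 : ℝ) := fun i => by
    simp [incl]
  have hb : ∀ i, |g (Finsupp.single i 1) / ν (Finsupp.single i 1)| ≤ 1 := by
    intro i
    rw [abs_div, abs_of_pos (hpos i), div_le_one (hpos i), ← hincl,
      ← canonicalExtension_incl ν hν]
    exact hgp _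
  let f : Cube := fun i => ⟨g (Finsupp.single i 1) / ν (Finsupp.single i 1), abs_le.1 (hb i)⟩
  have hf : ∀ w, combo (rescale ν f) w = g (incl w) := by
    intro w
    have h1 : rescale ν f = fun i => g (Finsupp.single i 1) :=
      funext fun i => mul_div_cancel₀ _ (hpos i).ne'
    rw [h1, combo]
    have h2 : Finsupp.linearCombination ℝ (fun i => g (Finsupp.single i 1)) = g := by
      ext i; simp
    rw [h2]
  refine ⟨f, fun w => ?_, ?_⟩
  · rw [hf, ← canonicalExtension_incl ν hν]
    exact hgp _
  · rw [hf, hg, canonicalExtension_incl]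

/-- Compactness gives a minimizer; the midpoint of two distinct minimizers would be strictly closer.
-/
theorem existsUnique_nearest {ν : V → ℝ} (hν : ν ∈ normsOnV) (q : Cube) :
    ∃! f, f ∈ dualBall ν ∧ ∀ g ∈ dualBall ν, sqDist f q ≤ sqDist g q := by
  obtain ⟨f, hf, hmin⟩ := (isClosed_dualBall ν).isCompact.exists_isMinOn
    ((exists_mem_dualBall_combo_eq hν 0).imp fun _ h => h.1)
    (f := fun f => sqDist f q) (continuous_sqDist.comp (by fun_prop :
      Continuous fun f : Cube => (f, q))).continuousOn
  refine ⟨f, ⟨hf, fun g hg => hmin hg⟩, fun g ⟨hg, hgmin⟩ => ?_⟩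
  have h1 := hgmin _ (cubeMid_mem_dualBall hg hf)
  have h2 := hgmin f hf
  have h3 : sqDist f q ≤ sqDist g q := hmin hg
  rw [sqDist_cubeMid] at h1
  exact eq_of_sqDist_le_zero (by linarith)

/-- The nearest point of the dual ball of `ν`. -/
def nearest (ν : normsOnV) (q : Cube) : Cube := (existsUnique_nearest ν.2 q).choose

theorem nearest_mem (ν : normsOnV) (q : Cube) : nearest ν q ∈ dualBall ν.1 :=
  (existsUnique_nearest ν.2 q).choose_spec.1.1

theorem sqDist_nearest_le (ν : normsOnV) (q : Cube) {g : Cube} (hg : g ∈ dualBall ν.1) :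
    sqDist (nearest ν q) q ≤ sqDist g q :=
  (existsUnique_nearest ν.2 q).choose_spec.1.2 g hg

theorem eq_nearest (ν : normsOnV) (q : Cube) {f : Cube} (hf : f ∈ dualBall ν.1)
    (h : sqDist f q ≤ sqDist (nearest ν q) q) : f = nearest ν q :=
  (existsUnique_nearest ν.2 q).choose_spec.2 f
    ⟨hf, fun _ hg => h.trans (sqDist_nearest_le ν q hg)⟩

theorem nearest_eq_self (ν : normsOnV) {f : Cube} (hf : f ∈ dualBall ν.1) : nearest ν f = f :=
  eq_of_sqDist_le_zero ((sqDist_nearest_le ν f hf).trans (sqDist_self f).le)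

/-- The preimage of a closed set is a projection, along the compact cube, of a closed set of pairs.
-/
theorem continuous_nearest (ν : normsOnV) : Continuous (nearest ν) := by
  refine continuous_iff_isClosed.2 fun C hC => ?_
  have : nearest ν ⁻¹' C = Prod.fst '' {p : Cube × Cube | p.2 ∈ C ∩ dualBall ν.1 ∧
      ∀ g ∈ dualBall ν.1, sqDist p.2 p.1 ≤ sqDist g p.1} := by
    ext q
    constructor
    · intro hq
      exact ⟨(q, nearest ν q), ⟨⟨hq, nearest_mem ν q⟩, fun g hg => sqDist_nearest_le ν q hg⟩, rfl⟩
    · rintro ⟨⟨q, f⟩, ⟨⟨hC, hf⟩, hmin⟩, rfl⟩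
      rw [Set.mem_preimage, ← eq_nearest ν q hf (hmin _ (nearest_mem ν q))]
      exact hC
  rw [this]
  refine isClosedMap_fst_of_compactSpace _ ?_
  refine IsClosed.and ((hC.inter (isClosed_dualBall ν.1)).preimage continuous_snd) ?_
  simp only [Set.ofPred_forall]
  exact isClosed_iInter fun g => isClosed_iInter fun _ => isClosed_le
    (continuous_sqDist.comp (by fun_prop : Continuous fun p : Cube × Cube => (p.2, p.1)))
    (continuous_sqDist.comp (by fun_prop : Continuous fun p : Cube × Cube => (g, p.1)))

/-- The nearest point lies in a closed `C` iff, for every rational `r`, the part of the dual ball in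
`C` has a point with `sqDist` at most `r` to `q` whenever the whole dual ball does. Each condition
compares two closed sets of norms, again projections along the compact cube. -/
theorem measurable_nearest (q : Cube) : Measurable fun ν : normsOnV => nearest ν q := by
  have hcont : Continuous fun f : Cube => sqDist f q :=
    continuous_sqDist.comp (by fun_prop : Continuous fun f : Cube => (f, q))
  have hmeas : ∀ C : Set Cube, IsClosed C → ∀ r : ℝ,
      MeasurableSet {ν : normsOnV | ∃ g ∈ dualBall ν.1, g ∈ C ∧ sqDist g q ≤ r} := by
    intro C hC r
    have : {ν : normsOnV | ∃ g ∈ dualBall ν.1, g ∈ C ∧ sqDist g q ≤ r} =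
        Prod.fst '' {p : normsOnV × Cube | p.2 ∈ dualBall p.1.1 ∧ p.2 ∈ C ∧ sqDist p.2 q ≤ r} := by
      ext ν
      exact ⟨fun ⟨g, h⟩ => ⟨(ν, g), h, rfl⟩, by rintro ⟨⟨ν, g⟩, h, rfl⟩; exact ⟨g, h⟩⟩
    rw [this]
    refine (isClosedMap_fst_of_compactSpace _ ?_).measurableSet
    exact (isClosed_setOf_mem_dualBall.preimage (by fun_prop :
      Continuous fun p : normsOnV × Cube => (p.1.1, p.2))).and
      ((hC.preimage continuous_snd).and (isClosed_le (hcont.comp continuous_snd) continuous_const))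
  refine measurable_of_isClosed fun C hC => ?_
  have : (fun ν : normsOnV => nearest ν q) ⁻¹' C = ⋂ r : ℚ,
      {ν : normsOnV | ∃ g ∈ dualBall ν.1, g ∈ Set.univ ∧ sqDist g q ≤ r}ᶜ ∪
        {ν | ∃ g ∈ dualBall ν.1, g ∈ C ∧ sqDist g q ≤ r} := by
    ext ν
    rw [Set.mem_iInter]
    constructor
    · intro hν r
      by_cases h : ν ∈ {ν : normsOnV | ∃ g ∈ dualBall ν.1, g ∈ Set.univ ∧ sqDist g q ≤ r}
      · obtain ⟨g, hg, -, hr⟩ := h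
        exact Or.inr ⟨_, nearest_mem ν q, hν, (sqDist_nearest_le ν q hg).trans hr⟩
      · exact Or.inl h
    · intro h
      have h' : ∀ r : ℚ, sqDist (nearest ν q) q < r → ∃ g ∈ dualBall ν.1, g ∈ C ∧ sqDist g q ≤ r :=
        fun r hr => (h r).resolve_left fun hn => hn ⟨_, nearest_mem ν q, trivial, hr.le⟩
      obtain ⟨r₀, hr₀⟩ := exists_rat_gt (sqDist (nearest ν q) q)
      obtain ⟨g₀, hg₀, hg₀C, -⟩ := h' r₀ hr₀
      obtain ⟨f, ⟨hf, hfC⟩, hmin⟩ := ((isClosed_dualBall ν.1).inter hC).isCompact.exists_isMinOn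
        ⟨g₀, hg₀, hg₀C⟩ hcont.continuousOn
      have hle : sqDist f q ≤ sqDist (nearest ν q) q := by
        by_contra! hlt
        obtain ⟨r, hr1, hr2⟩ := exists_rat_btwn hlt
        obtain ⟨g, hg, hgC, hgr⟩ := h' r hr1
        exact absurd ((hmin ⟨hg, hgC⟩ : sqDist f q ≤ sqDist g q).trans hgr) (not_le.2 hr2)
      rw [Set.mem_preimage, ← eq_nearest ν q hf hle]
      exact hfC
  rw [this]
  exact MeasurableSet.iInter fun r => (hmeas _ isClosed_univ r).compl.union (hmeas C hC r)

/-- A sequence in `C(Cube, ℝ)` that realizes `ν`. -/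
def realize (ν : normsOnV) (i : ℕ) : C(Cube, ℝ) :=
  ⟨fun q => rescale ν.1 (nearest ν q) i, by
    have := continuous_nearest ν
    unfold rescale
    fun_prop⟩

theorem combo_realize_apply (ν : normsOnV) (v : V) (q : Cube) :
    combo (realize ν) v q = combo (rescale ν.1 (nearest ν q)) v := by
  rw [combo_eq_sum, combo_eq_sum]
  simp [realize]

/-- Values of `nearest` lie in the dual ball, which bounds the norm above; a norming functional is
fixed by `nearest`, so the bound is attained. -/
theorem norm_combo_realize (ν : normsOnV) (v : V) : ‖combo (realize ν) v‖ = ν.1 v := by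
  refine le_antisymm ((ContinuousMap.norm_le _ (norm_nonneg_of_mem ν.2 v)).2 fun q => ?_) ?_
  · rw [combo_realize_apply, Real.norm_eq_abs]
    exact nearest_mem ν q v
  · obtain ⟨f, hf, hfv⟩ := exists_mem_dualBall_combo_eq ν.2 v
    refine le_trans ?_ ((combo (realize ν) v).norm_coe_le_norm f)
    rw [combo_realize_apply, nearest_eq_self ν hf, hfv]
    exact le_abs_self _

/-- A closed ball for the supremum norm is cut out by evaluations at a dense sequence, and each
evaluation is measurable in `ν`. -/
theorem measurable_realize [MeasurableSpace C(Cube, ℝ)] [BorelSpace C(Cube, ℝ)] :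
    Measurable realize := by
  refine measurable_pi_iff.2 fun i => measurable_of_measurableSet_preimage_closedBall fun g r => ?_
  have hev : ∀ q, Measurable fun ν : normsOnV => realize ν i q := by
    intro q
    have h1 : Measurable fun ν : normsOnV => (nearest ν q i : ℝ) :=
      measurable_subtype_coe.comp ((measurable_pi_apply i).comp (measurable_nearest q))
    exact ((measurable_pi_apply _).comp measurable_subtype_coe).mul h1
  have : Nonempty Cube := ⟨fun _ => ⟨0, by norm_num⟩⟩
  have : (fun ν => realize ν i) ⁻¹' Metric.closedBall g r =
      ⋂ n, {ν | dist (realize ν i (denseSeq Cube n)) (g (denseSeq Cube n)) ≤ r} := by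
    ext ν
    rw [Set.mem_preimage, Metric.mem_closedBall, ContinuousMap.dist_le_iff_of_nonempty,
      Set.mem_iInter]
    refine ⟨fun h n => h _, fun h q => ?_⟩
    exact (denseRange_denseSeq Cube).induction_on
      (p := fun q => dist (realize ν i q) (g q) ≤ r) q
      (isClosed_le (by fun_prop) continuous_const) h
  rw [this]
  exact MeasurableSet.iInter fun n =>
    measurableSet_le ((hev _).dist measurable_const) measurable_const

theorem measurableSet_normsOnV : MeasurableSet normsOnV := by
  have h : normsOnV = ⋂ v : V, ⋂ w : V, ⋂ q : ℚ, {ν | (ν v = 0 ↔ v = 0) ∧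
      ν (v + w) ≤ ν v + ν w ∧ ν (q • v) = |(q : ℝ)| * ν v} := by
    ext ν
    simp only [Set.mem_iInter]
    exact ⟨fun h v w q => ⟨h.1 v, h.2.1 v w, h.2.2 q v⟩,
      fun h => ⟨fun v => (h v 0 0).1, fun v w => (h v w 0).2.1, fun q v => (h v 0 q).2.2⟩⟩
  rw [h]
  refine MeasurableSet.iInter fun v => MeasurableSet.iInter fun w => MeasurableSet.iInter fun q => ?_
  have h1 : MeasurableSet {ν : V → ℝ | ν v = 0 ↔ v = 0} := by
    by_cases hv : v = 0
    · simp only [hv, iff_true]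
      exact measurableSet_eq_fun (by fun_prop) (by fun_prop)
    · simp only [hv, iff_false]
      exact (measurableSet_eq_fun (by fun_prop) (by fun_prop)).compl
  have h2 : MeasurableSet {ν : V → ℝ | ν (v + w) ≤ ν v + ν w} :=
    measurableSet_le (by fun_prop) (by fun_prop)
  have h3 : MeasurableSet {ν : V → ℝ | ν (q • v) = |(q : ℝ)| * ν v} :=
    measurableSet_eq_fun (by fun_prop) (by fun_prop)
  exact h1.inter (h2.inter h3)

/-- By `mem_codes_iff`, a norm is a code iff its realization is independent, which is a Borel
condition. -/
theorem measurableSet_codes : MeasurableSet codes := by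
  borelize C(Cube, ℝ)
  have h : codes = Subtype.val '' (realize ⁻¹' {x | LinearIndependent ℝ x}) := by
    ext ν
    constructor
    · intro h
      exact ⟨⟨ν, h.1⟩, (mem_codes_iff h.1 (norm_combo_realize ⟨ν, h.1⟩)).1 h, rfl⟩
    · rintro ⟨ν, h, rfl⟩
      exact (mem_codes_iff ν.2 (norm_combo_realize ν)).2 h
  rw [h]
  exact measurableSet_normsOnV.subtype_image (measurable_realize measurableSet_linearIndependent)

end

end BanachCoding

/-! ### From codes to subspaces. -/

namespace BanachCoding

noncomputable section

/-- The codes embed into `SB(X)`, in a Borel way and with the isometry class kept. -/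
theorem exists_measurable_injective_codes_SB {X : Type*} [NormedAddCommGroup X] [NormedSpace ℝ X]
    [CompleteSpace X] [SeparableSpace X] [MeasurableSpace X] [BorelSpace X] (hX : IsUniversal X) :
    ∃ f : codes → SB X, Measurable f ∧ Function.Injective f ∧
      ∀ ν, Nonempty (CodedSpace ν ≃ₗᵢ[ℝ] (f ν).1.toSubmodule) := by
  borelize C(Cube, ℝ)
  have : SecondCountableTopology X := UniformSpace.secondCountable_of_separable X
  have : StandardBorelSpace codes := measurableSet_codes.standardBorel
  obtain ⟨φ, hφ⟩ := MeasureTheory.exists_measurableEmbedding_real codes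
  obtain ⟨J⟩ := hX (C(Cube, ℝ) × C(Cube, ℝ))
  -- The sigmoid puts the label of `ν` in `[0, 1]`, so that `g ↦ (g, t ν • g)` is isometric for the
  -- maximum norm on the product.
  let t : codes → ℝ := fun ν => Real.sigmoid (φ ν)
  have ht0 : ∀ ν, 0 ≤ t ν := fun ν => Real.sigmoid_nonneg _
  have ht1 : ∀ ν, t ν ≤ 1 := fun ν => Real.sigmoid_le_one _
  have htm : Measurable t := continuous_sigmoid.measurable.comp hφ.measurable
  have htinj : Function.Injective t := Real.sigmoid_injective.comp hφ.injective
  let T : ℝ → C(Cube, ℝ) →L[ℝ] X := fun c =>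
    J.toContinuousLinearMap.comp ((ContinuousLinearMap.id ℝ _).prod
      (c • ContinuousLinearMap.id ℝ _))
  have hT : ∀ c g, T c g = J (g, c • g) := fun c g => rfl
  have hTnorm : ∀ ν g, ‖T (t ν) g‖ = ‖g‖ := by
    intro ν g
    rw [hT, J.norm_map, Prod.norm_mk, norm_smul, Real.norm_of_nonneg (ht0 ν)]
    exact max_eq_left (mul_le_of_le_one_left (norm_nonneg _) (ht1 ν))
  let y : codes → ℕ → C(Cube, ℝ) := fun ν => realize ⟨ν.1, ν.2.1⟩
  have hy : Measurable y := measurable_realize.comp (measurable_subtype_coe.subtype_mk)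
  let x : codes → ℕ → X := fun ν i => T (t ν) (y ν i)
  have hcombo : ∀ ν v, combo (x ν) v = T (t ν) (combo (y ν) v) := by
    intro ν v
    simp only [combo_eq_sum, map_sum, map_smul, x]
  have hnorm : ∀ ν v, ‖combo (x ν) v‖ = ν.1 v := by
    intro ν v
    rw [hcombo, hTnorm]
    exact norm_combo_realize ⟨ν.1, ν.2.1⟩ v
  have hli : ∀ ν, LinearIndependent ℝ (x ν) := fun ν => (mem_codes_iff ν.2.1 (hnorm ν)).1 ν.2
  refine ⟨fun ν => closedSpan ⟨x ν, hli ν⟩, measurable_closedSpan.comp (Measurable.subtype_mk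
    (measurable_pi_iff.2 fun i => ?_)), fun ν μ h => htinj ?_,
    fun ν => nonempty_codedSpace_equiv_closedSpan ν _ (hnorm ν)⟩
  · have h1 : Measurable fun ν => y ν i := (measurable_pi_apply i).comp hy
    have : SecondCountableTopology C(Cube, ℝ) := inferInstance
    exact J.continuous.measurable.comp (h1.prodMk (htm.smul h1))
  -- If the closed spans agree, the nonzero vector `x ν 0` lies in the images under `J` of the
  -- graphs of both `t ν • id` and `t μ • id`, which forces `t ν = t μ`.
  · have hmem : x ν 0 ∈ closure (Submodule.span ℝ (Set.range (x μ)) : Set X) := by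
      have h1 : closure (Submodule.span ℝ (Set.range (x ν)) : Set X) =
          closure (Submodule.span ℝ (Set.range (x μ)) : Set X) := by
        have := congrArg (fun Z : SB X => (Z.1 : Set X)) h
        simpa only [coe_closedSpan] using this
      rw [← h1]
      exact subset_closure (Submodule.subset_span ⟨0, rfl⟩)
    have hclosed : IsClosed (Set.range (T (t μ))) :=
      (AddMonoidHomClass.isometry_of_norm (T (t μ)) (hTnorm μ)).isClosedEmbedding.isClosed_range
    have hsub : closure (Submodule.span ℝ (Set.range (x μ)) : Set X) ⊆ Set.range (T (t μ)) := by
      refine closure_minimal ?_ hclosed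
      have : Submodule.span ℝ (Set.range (x μ)) ≤ LinearMap.range (T (t μ)).toLinearMap := by
        refine Submodule.span_le.2 ?_
        rintro _ ⟨i, rfl⟩
        exact ⟨y μ i, rfl⟩
      exact this
    obtain ⟨g, hg⟩ := hsub hmem
    have h2 : (g, t μ • g) = (y ν 0, t ν • y ν 0) := J.injective hg
    obtain ⟨rfl, h3⟩ := Prod.mk.inj h2
    have h4 : y ν 0 ≠ 0 := by
      intro h0
      refine (hli ν).ne_zero 0 ?_
      change T (t ν) (y ν 0) = 0
      rw [h0, map_zero]
    exact (smul_left_injective ℝ h4 h3).symm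

end

end BanachCoding

theorem mainTheorem10 {X : Type*} [NormedAddCommGroup X] [NormedSpace ℝ X] [CompleteSpace X]
    [TopologicalSpace.SeparableSpace X] (hX : BanachCoding.IsUniversal X) :
    ∃ Θ : BanachCoding.codes ≃ᵐ BanachCoding.SB X,
      ∀ ν : BanachCoding.codes,
        Nonempty (BanachCoding.CodedSpace ν ≃ₗᵢ[ℝ] (Θ ν).1.toSubmodule) := by
  borelize X
  have : StandardBorelSpace BanachCoding.codes :=
    BanachCoding.measurableSet_codes.standardBorel
  have : StandardBorelSpace (BanachCoding.SB X) := BanachCoding.standardBorelSpace_SB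
  obtain ⟨f, hf, hfinj, hfi⟩ := BanachCoding.exists_measurable_injective_codes_SB hX
  obtain ⟨g, hg, hginj, hgi⟩ := BanachCoding.exists_measurable_injective_SB_codes (E := X)
  -- Lusin–Souslin turns both injective Borel maps into measurable embeddings.
  obtain ⟨Θ, hΘ⟩ := (hf.measurableEmbedding hfinj).exists_measurableEquiv_eq_or
    (hg.measurableEmbedding hginj)
  refine ⟨Θ, fun ν => ?_⟩
  rcases hΘ ν with h | h
  · rw [h]
    exact hfi ν
  · have := hgi (Θ ν)
    rwa [h] at this
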